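/- Let $A$ be a (not necessarily unital) $C^*$-algebra. By an ideal we mean a norm-closed two-sided ideal; every ideal of $A$ is itself a $C^*$-algebra. For a $C^*$-algebra $B$ let $Z(B)$ denote its centre. An ideal $I$ of $B$ is modular if $B/I$ is unital, and $\mathrm{Max}(B)$ denotes the (possibly empty) set of modular maximal ideals of $B$. The $C^*$-algebra $B$ is weakly central if no $M\in\mathrm{Max}(B)$ contains $Z(B)$ and, for all $M_1,M_2\in\mathrm{Max}(B)$, $M_1\cap Z(B)=M_2\cap Z(B)$ implies $M_1=M_2$. It has the centre-quotient property (CQ-property) if $q_I(Z(B))=Z(B/I)$ for every ideal $I$ of $B$, where $q_I\colon B\to B/I$ is the canonical map. Let $T_A^1$ be the set of all $M\in\mathrm{Max}(A)$ with $Z(A)\subseteq M$, let $T_A^2$ be the set of all $M\in\mathrm{Max}(A)$ for which there is $N\in\mathrm{Max}(A)$ with $N\neq M$, $Z(A)\nsubseteq M$, $Z(A)\nsubseteq N$ and $M\cap Z(A)=N\cap Z(A)$, and put $T_A=T_A^1\cup T_A^2$. Let $\ker T_A$ be the intersection of all members of $T_A$, with $\ker T_A=A$ if $T_A=\emptyset$.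 Then $\ker T_A$ is the largest weakly central ideal $J_{wc}(A)$ of $A$: it is weakly central and contains every weakly central ideal of $A$. Moreover, $\ker T_A$ is also the largest ideal of $A$ with the CQ-property: it has the CQ-property and contains every ideal of $A$ with the CQ-property. -/

import Mathlib

namespace CentreQuotient

open Filter Topology

/-- An ideal of a C⋆-algebra: a norm-closed two-sided ideal. (Such an ideal is automatically a
complex subspace and self-adjoint, see `ClosedIdeal.smul_mem` and `ClosedIdeal.star_mem`.) -/
structure ClosedIdeal (A : Type*) [NonUnitalCStarAlgebra A] extends TwoSidedIdeal A where
  isClosed' : IsClosed (toTwoSidedIdeal : Set A)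

namespace ClosedIdeal

section Basic

variable {A : Type*} [NonUnitalCStarAlgebra A]

instance : SetLike (ClosedIdeal A) A where
  coe I := (I.toTwoSidedIdeal : Set A)
  coe_injective I J h := by
    cases I; cases J; congr; exact SetLike.coe_injective h

/-- Ideals are ordered by inclusion. -/
instance : PartialOrder (ClosedIdeal A) := .ofSetLike (ClosedIdeal A) A

instance : NonUnitalSubringClass (ClosedIdeal A) A where
  add_mem {I} _ _ ha hb := I.toTwoSidedIdeal.add_mem ha hb
  zero_mem I := I.toTwoSidedIdeal.zero_mem
  mul_mem {I} _ _ _ hb := I.toTwoSidedIdeal.mul_mem_left _ _ hb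
  neg_mem {I} _ ha := I.toTwoSidedIdeal.neg_mem ha

theorem mul_mem_left (I : ClosedIdeal A) (x : A) {y : A} (hy : y ∈ I) : x * y ∈ I :=
  I.toTwoSidedIdeal.mul_mem_left x y hy

theorem mul_mem_right (I : ClosedIdeal A) {x : A} (y : A) (hx : x ∈ I) : x * y ∈ I :=
  I.toTwoSidedIdeal.mul_mem_right x y hx

theorem smul_mem (I : ClosedIdeal A) (c : ℂ) {x : A} (hx : x ∈ I) : c • x ∈ I := by
  let _ := CStarAlgebra.spectralOrder A
  let _ := CStarAlgebra.spectralOrderedRing A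
  have h := (CStarAlgebra.increasingApproximateUnit A).tendsto_mul_right (c • x)
  refine I.isClosed'.mem_of_tendsto h (Eventually.of_forall fun e => ?_)
  have : e * (c • x) = (c • e) * x := by rw [mul_smul_comm, smul_mul_assoc]
  rw [this]
  exact I.mul_mem_left _ hx

/-- The ⋆-subalgebra `I ∩ I⋆`, used only to show that ideals are self-adjoint. -/
def interStar (I : ClosedIdeal A) : NonUnitalStarSubalgebra ℂ A where
  carrier := {x | x ∈ I ∧ star x ∈ I}
  add_mem' ha hb := ⟨add_mem ha.1 hb.1, by rw [star_add]; exact add_mem ha.2 hb.2⟩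
  zero_mem' := ⟨zero_mem I, by rw [star_zero]; exact zero_mem I⟩
  mul_mem' ha hb := ⟨mul_mem ha.1 hb.1, by rw [star_mul]; exact mul_mem hb.2 ha.2⟩
  smul_mem' c x hx := ⟨I.smul_mem c hx.1, by rw [star_smul]; exact I.smul_mem _ hx.2⟩
  star_mem' {x} hx := ⟨hx.2, by rw [star_star]; exact hx.1⟩

theorem star_mem (I : ClosedIdeal A) {x : A} (hx : x ∈ I) : star x ∈ I := by
  have hcl : IsClosed (I.interStar : Set A) :=
    IsClosed.inter I.isClosed' (I.isClosed'.preimage continuous_star)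
  let _ : NonUnitalCStarAlgebra I.interStar :=
    NonUnitalStarSubalgebra.nonUnitalCStarAlgebra I.interStar (h_closed := hcl)
  let _ := CStarAlgebra.spectralOrder I.interStar
  let _ := CStarAlgebra.spectralOrderedRing I.interStar
  have hl := CStarAlgebra.increasingApproximateUnit I.interStar
  have hmem : x * star x ∈ I.interStar :=
    ⟨I.mul_mem_right _ hx, by rw [star_mul, star_star]; exact I.mul_mem_right _ hx⟩
  let a : I.interStar := ⟨x * star x, hmem⟩
  have h1 : Tendsto (fun e : I.interStar => 2 * ‖a - a * e‖)
      (CStarAlgebra.approximateUnit I.interStar) (𝓝 0) := by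
    have := ((hl.tendsto_mul_left a).const_sub a).norm.const_mul 2
    simpa using this
  have h2 : Tendsto (fun e : I.interStar => ‖star x - star x * (e : A)‖ * ‖star x - star x * (e : A)‖)
      (CStarAlgebra.approximateUnit I.interStar) (𝓝 0) := by
    refine squeeze_zero' (Eventually.of_forall fun e => by positivity) ?_ h1
    filter_upwards [hl.eventually_norm, hl.eventually_star_eq] with e he hs
    have hs' : star (e : A) = e := congrArg Subtype.val hs
    rw [← CStarRing.norm_star_mul_self]
    have key : star (star x - star x * (e : A)) * (star x - star x * (e : A)) =
        ((a - a * e : I.interStar) : A) - (e : A) * ((a - a * e : I.interStar) : A) := by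
      simp only [star_sub, star_mul, star_star, hs', a,
        AddSubgroupClass.coe_sub, MulMemClass.coe_mul]
      noncomm_ring
    rw [key]
    have he' : ‖(e : A)‖ ≤ 1 := he
    have hn : ‖((a - a * e : I.interStar) : A)‖ = ‖a - a * e‖ := rfl
    calc _ ≤ ‖((a - a * e : I.interStar) : A)‖ + ‖(e : A) * ((a - a * e : I.interStar) : A)‖ :=
          norm_sub_le _ _
      _ ≤ ‖a - a * e‖ + 1 * ‖a - a * e‖ := by
          rw [← hn]
          gcongr
          exact (norm_mul_le _ _).trans (by gcongr)
      _ = 2 * ‖a - a * e‖ := by ring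
  have h3 : Tendsto (fun e : I.interStar => star x * (e : A))
      (CStarAlgebra.approximateUnit I.interStar) (𝓝 (star x)) := by
    rw [tendsto_iff_norm_sub_tendsto_zero]
    have h4 := h2.sqrt
    simp only [Real.sqrt_mul_self (norm_nonneg _), Real.sqrt_zero] at h4
    simpa only [norm_sub_rev] using h4
  exact I.isClosed'.mem_of_tendsto h3 (Eventually.of_forall fun e => I.mul_mem_left _ e.2.1)

instance : SMulMemClass (ClosedIdeal A) ℂ A where
  smul_mem {I} c _ hx := I.smul_mem c hx

instance : StarMemClass (ClosedIdeal A) A where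
  star_mem {I} _ hx := I.star_mem hx

/-- An ideal of a C⋆-algebra is itself a C⋆-algebra, with the restricted operations and norm. -/
noncomputable instance instCStar (I : ClosedIdeal A) : NonUnitalCStarAlgebra I :=
  NonUnitalStarSubalgebra.nonUnitalCStarAlgebra I (h_closed := I.isClosed')

/-- The whole algebra is the largest ideal. -/
instance : OrderTop (ClosedIdeal A) where
  top := ⟨⊤, isClosed_univ⟩
  le_top _ _ _ := trivial

/-- The quotient algebra `A / I`. -/
abbrev QuotAlg (I : ClosedIdeal A) : Type _ := I.toTwoSidedIdeal.ringCon.Quotient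

/-- The canonical map `A → A / I`. -/
def quotMap (I : ClosedIdeal A) : A → I.QuotAlg := fun a => (a : I.toTwoSidedIdeal.ringCon.Quotient)

/-- An ideal `I` is modular if `A / I` is unital. -/
def IsModular (I : ClosedIdeal A) : Prop :=
  ∃ e : I.QuotAlg, ∀ x : I.QuotAlg, e * x = x ∧ x * e = x

/-- The kernel of a set of ideals: the intersection of its members, which is `A` for `S = ∅`. -/
def ker (S : Set (ClosedIdeal A)) : ClosedIdeal A where
  toTwoSidedIdeal := sInf (ClosedIdeal.toTwoSidedIdeal '' S)
  isClosed' := by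
    have : ((sInf (ClosedIdeal.toTwoSidedIdeal '' S) : TwoSidedIdeal A) : Set A) =
        ⋂ I ∈ S, (I.toTwoSidedIdeal : Set A) := by
      ext x
      simp [TwoSidedIdeal.mem_sInf]
    rw [this]
    exact isClosed_biInter fun I _ => I.isClosed'

theorem mem_ker {S : Set (ClosedIdeal A)} {x : A} : x ∈ ker S ↔ ∀ I ∈ S, x ∈ I := by
  change x ∈ sInf (ClosedIdeal.toTwoSidedIdeal '' S) ↔ _
  rw [TwoSidedIdeal.mem_sInf]
  exact Set.forall_mem_image

end Basic

end ClosedIdeal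

section Main

variable (A : Type*) [NonUnitalCStarAlgebra A]

/-- The set `Max(A)` of modular maximal ideals of `A`. -/
def MaxIdeals : Set (ClosedIdeal A) := {M | IsCoatom M ∧ M.IsModular}

/-- `A` is weakly central if no modular maximal ideal contains the centre `Z(A)`, and modular
maximal ideals are separated by their intersections with `Z(A)`. -/
def IsWeaklyCentral : Prop :=
  (∀ M ∈ MaxIdeals A, ¬ Set.center A ⊆ (M : Set A)) ∧
    ∀ M₁ ∈ MaxIdeals A, ∀ M₂ ∈ MaxIdeals A,
      (M₁ : Set A) ∩ Set.center A = (M₂ : Set A) ∩ Set.center A → M₁ = M₂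

/-- The centre-quotient property: `q_I(Z(A)) = Z(A / I)` for every ideal `I` of `A`. -/
def HasCQProperty : Prop :=
  ∀ I : ClosedIdeal A, I.quotMap '' Set.center A = Set.center I.QuotAlg

/-- The modular maximal ideals of `A` that contain `Z(A)`. -/
def T₁ : Set (ClosedIdeal A) := {M | M ∈ MaxIdeals A ∧ Set.center A ⊆ (M : Set A)}

/-- The modular maximal ideals `M` of `A` for which there is another modular maximal ideal `N`
with `Z(A) ⊈ M, N` and `M ∩ Z(A) = N ∩ Z(A)`. -/
def T₂ : Set (ClosedIdeal A) :=
  {M | M ∈ MaxIdeals A ∧ ∃ N ∈ MaxIdeals A, M ≠ N ∧ ¬ Set.center A ⊆ (M : Set A) ∧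
    ¬ Set.center A ⊆ (N : Set A) ∧
    (M : Set A) ∩ Set.center A = (N : Set A) ∩ Set.center A}

/-- The set `T_A` of modular maximal ideals witnessing the failure of weak centrality of `A`. -/
def T : Set (ClosedIdeal A) := T₁ A ∪ T₂ A

end Main

end CentreQuotient

namespace CentreQuotient

open Filter Topology

namespace ClosedIdeal

section Quotient

variable {A : Type*} [NonUnitalCStarAlgebra A]

/-- For a positive contraction `e`, right multiplication by `1 - e` is contractive. -/
theorem norm_sub_mul_le_of_nonneg [PartialOrder A] [StarOrderedRing A] {e : A} (he : 0 ≤ e)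
    (he1 : ‖e‖ ≤ 1) (a : A) : ‖a - a * e‖ ≤ ‖a‖ := by
  have h0 : (0 : Unitization ℂ A) ≤ (e : Unitization ℂ A) := by rwa [Unitization.inr_nonneg_iff]
  have h1 : (e : Unitization ℂ A) ≤ 1 := by
    rw [← CStarAlgebra.norm_le_one_iff_of_nonneg _ h0, Unitization.norm_inr]; exact he1
  have h2 : ‖(1 : Unitization ℂ A) - e‖ ≤ 1 := by
    rw [CStarAlgebra.norm_le_one_iff_of_nonneg _ (sub_nonneg.2 h1)]
    exact sub_le_self _ h0
  rw [← Unitization.norm_inr (𝕜 := ℂ), ← Unitization.norm_inr (𝕜 := ℂ) (a := a)]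
  have : ((a - a * e : A) : Unitization ℂ A) = (a : Unitization ℂ A) * (1 - e) := by
    rw [mul_sub, mul_one, Unitization.inr_sub, Unitization.inr_mul]
  rw [this]
  calc _ ≤ ‖(a : Unitization ℂ A)‖ * ‖(1 : Unitization ℂ A) - e‖ := norm_mul_le _ _
    _ ≤ ‖(a : Unitization ℂ A)‖ * 1 := by gcongr
    _ = _ := mul_one _

/-- An ideal absorbs a bounded approximate unit whose complement is contractive on `A`. -/
theorem exists_approx_unit (I : ClosedIdeal A) {x : A} (hx : x ∈ I) {ε : ℝ} (hε : 0 < ε) :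
    ∃ e ∈ I, star e = e ∧ (∀ a : A, ‖a - a * e‖ ≤ ‖a‖) ∧ ‖x - x * e‖ < ε ∧ ‖x - e * x‖ < ε := by
  let _ := CStarAlgebra.spectralOrder I
  let _ := CStarAlgebra.spectralOrderedRing I
  let _ := CStarAlgebra.spectralOrder A
  let _ := CStarAlgebra.spectralOrderedRing A
  have hl := CStarAlgebra.increasingApproximateUnit I
  have h1 := hl.tendsto_mul_left ⟨x, hx⟩
  have h2 := hl.tendsto_mul_right ⟨x, hx⟩
  obtain ⟨e, he1, he2, he3, he4⟩ := ((Metric.tendsto_nhds.1 h1 ε hε).and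
    ((Metric.tendsto_nhds.1 h2 ε hε).and (hl.eventually_nonneg.and hl.eventually_norm))).exists
  refine ⟨e, e.2, congrArg Subtype.val (IsSelfAdjoint.of_nonneg he3).star_eq, fun a => ?_, ?_, ?_⟩
  · refine norm_sub_mul_le_of_nonneg (e := (e : A)) ?_ he4 a
    obtain ⟨s, hs⟩ := CStarAlgebra.nonneg_iff_eq_star_mul_self.1 he3
    have : (e : A) = star (s : A) * s := congrArg Subtype.val hs
    rw [this]
    exact star_mul_self_nonneg _
  · rw [dist_comm, dist_eq_norm] at he1; exact he1
  · rw [dist_comm, dist_eq_norm] at he2; exact he2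

/-- An ideal as a complex subspace. -/
def toSubmodule (I : ClosedIdeal A) : Submodule ℂ A where
  carrier := I
  add_mem' := add_mem
  zero_mem' := zero_mem I
  smul_mem' c _ hx := I.smul_mem c hx

instance (I : ClosedIdeal A) : IsClosed (I.toSubmodule : Set A) := I.isClosed'

/-- The quotient of `A` by `I`, carrying the quotient norm. -/
abbrev CStarQuot (I : ClosedIdeal A) : Type _ := A ⧸ I.toSubmodule

variable (I : ClosedIdeal A)

/-- The class of an element of `A` in the quotient C⋆-algebra. -/
abbrev toQuot (a : A) : I.CStarQuot := Submodule.Quotient.mk a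

theorem toQuot_eq_iff {a b : A} : I.toQuot a = I.toQuot b ↔ a - b ∈ I := Submodule.Quotient.eq _

theorem toQuot_eq_zero {a : A} : I.toQuot a = 0 ↔ a ∈ I := Submodule.Quotient.mk_eq_zero _

theorem toQuot_surjective : Function.Surjective I.toQuot := Submodule.Quotient.mk_surjective _

instance : Mul I.CStarQuot where
  mul := Quotient.map₂ (· * ·) fun a a' ha b b' hb => by
    have ha' : a - a' ∈ I := (Submodule.quotientRel_def _).1 ha
    have hb' : b - b' ∈ I := (Submodule.quotientRel_def _).1 hb
    refine (Submodule.quotientRel_def _).2 (?_ : a * b - a' * b' ∈ I)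
    have : a * b - a' * b' = (a - a') * b + a' * (b - b') := by noncomm_ring
    rw [this]
    exact add_mem (I.mul_mem_right _ ha') (I.mul_mem_left _ hb')

instance : Star I.CStarQuot where
  star := Quotient.map star fun a b h => by
    have h' : a - b ∈ I := (Submodule.quotientRel_def _).1 h
    refine (Submodule.quotientRel_def _).2 (?_ : star a - star b ∈ I)
    rw [← star_sub]
    exact I.star_mem h'

theorem toQuot_mul (a b : A) : I.toQuot (a * b) = I.toQuot a * I.toQuot b := rfl

theorem toQuot_star (a : A) : I.toQuot (star a) = star (I.toQuot a) := rfl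

theorem norm_toQuot_le (a : A) : ‖I.toQuot a‖ ≤ ‖a‖ := Submodule.Quotient.norm_mk_le _ _

theorem exists_norm_lt (x : I.CStarQuot) {ε : ℝ} (hε : 0 < ε) :
    ∃ a, I.toQuot a = x ∧ ‖a‖ < ‖x‖ + ε := Submodule.Quotient.norm_mk_lt x hε

theorem norm_mul_self_le_quot (x : I.CStarQuot) : ‖x‖ * ‖x‖ ≤ ‖star x * x‖ := by
  obtain ⟨a, rfl⟩ := I.toQuot_surjective x
  refine le_of_forall_pos_lt_add fun ε hε => ?_
  obtain ⟨b, hb, hbn⟩ := I.exists_norm_lt (star (I.toQuot a) * I.toQuot a) (half_pos hε)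
  have hi : star a * a - b ∈ I := by
    rw [← toQuot_eq_iff, hb, toQuot_mul, toQuot_star]
  obtain ⟨e, heI, hes, hec, hex, -⟩ := I.exists_approx_unit hi (half_pos hε)
  have h1 : ‖I.toQuot a‖ ≤ ‖a - a * e‖ := by
    have : I.toQuot a = I.toQuot (a - a * e) := by
      rw [toQuot_eq_iff, sub_sub_cancel]; exact I.mul_mem_left _ heI
    rw [this]; exact I.norm_toQuot_le _
  have h2 : ‖a - a * e‖ * ‖a - a * e‖ ≤ ‖star a * a - star a * a * e‖ := by
    rw [← CStarRing.norm_star_mul_self]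
    have : star (a - a * e) * (a - a * e) =
        star (star (star a * a - star a * a * e) - star (star a * a - star a * a * e) * e) := by
      simp only [star_sub, star_mul, star_star, hes]
      noncomm_ring
    rw [this, norm_star]
    exact (hec _).trans (norm_star _).le
  calc ‖I.toQuot a‖ * ‖I.toQuot a‖ ≤ ‖a - a * e‖ * ‖a - a * e‖ := by gcongr
    _ ≤ ‖star a * a - star a * a * e‖ := h2
    _ = ‖(b - b * e) + ((star a * a - b) - (star a * a - b) * e)‖ := by
      congr 1; noncomm_ring
    _ ≤ ‖b - b * e‖ + ‖(star a * a - b) - (star a * a - b) * e‖ := norm_add_le _ _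
    _ < (‖star (I.toQuot a) * I.toQuot a‖ + ε / 2) + ε / 2 :=
      add_lt_add_of_le_of_lt ((hec b).trans hbn.le) hex
    _ = _ := by ring

theorem norm_mul_le_quot (x y : I.CStarQuot) : ‖x * y‖ ≤ ‖x‖ * ‖y‖ := by
  refine le_of_forall_gt_imp_ge_of_dense fun c hc => ?_
  have hcont : Tendsto (fun ε : ℝ => (‖x‖ + ε) * (‖y‖ + ε)) (𝓝[>] 0) (𝓝 (‖x‖ * ‖y‖)) := by
    have : Continuous (fun ε : ℝ => (‖x‖ + ε) * (‖y‖ + ε)) := by fun_prop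
    simpa using (this.tendsto 0).mono_left nhdsWithin_le_nhds
  obtain ⟨ε, hε1, hε2⟩ := ((hcont.eventually_lt_const hc).and self_mem_nhdsWithin).exists
  obtain ⟨a, rfl, ha⟩ := I.exists_norm_lt x hε2
  obtain ⟨b, rfl, hb⟩ := I.exists_norm_lt y hε2
  calc ‖I.toQuot a * I.toQuot b‖ ≤ ‖a * b‖ := I.norm_toQuot_le (a * b)
    _ ≤ ‖a‖ * ‖b‖ := norm_mul_le _ _
    _ ≤ (‖I.toQuot a‖ + ε) * (‖I.toQuot b‖ + ε) := by gcongr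
    _ ≤ c := hε1.le

/-- The quotient of a C⋆-algebra by a closed ideal is a C⋆-algebra. -/
noncomputable instance instCStarQuot : NonUnitalCStarAlgebra I.CStarQuot where
  __ := (inferInstance : NormedAddCommGroup I.CStarQuot)
  __ := (inferInstance : NormedSpace ℂ I.CStarQuot)
  __ := (inferInstance : CompleteSpace I.CStarQuot)
  left_distrib := by
    rintro ⟨a⟩ ⟨b⟩ ⟨c⟩; exact congrArg I.toQuot (mul_add a b c)
  right_distrib := by
    rintro ⟨a⟩ ⟨b⟩ ⟨c⟩; exact congrArg I.toQuot (add_mul a b c)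
  zero_mul := by rintro ⟨a⟩; exact congrArg I.toQuot (zero_mul a)
  mul_zero := by rintro ⟨a⟩; exact congrArg I.toQuot (mul_zero a)
  mul_assoc := by rintro ⟨a⟩ ⟨b⟩ ⟨c⟩; exact congrArg I.toQuot (mul_assoc a b c)
  norm_mul_le := I.norm_mul_le_quot
  star_involutive := by rintro ⟨a⟩; exact congrArg I.toQuot (star_star a)
  star_mul := by rintro ⟨a⟩ ⟨b⟩; exact congrArg I.toQuot (star_mul a b)
  star_add := by rintro ⟨a⟩ ⟨b⟩; exact congrArg I.toQuot (star_add a b)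
  norm_mul_self_le := I.norm_mul_self_le_quot
  smul_assoc := by rintro c ⟨a⟩ ⟨b⟩; exact congrArg I.toQuot (smul_mul_assoc c a b)
  smul_comm := by rintro c ⟨a⟩ ⟨b⟩; exact congrArg I.toQuot (mul_smul_comm c a b).symm
  star_smul := by rintro c ⟨a⟩; exact congrArg I.toQuot (star_smul c a)

/-- The canonical ⋆-homomorphism onto the quotient C⋆-algebra. -/
def quotHom : A →⋆ₙₐ[ℂ] I.CStarQuot where
  toFun := I.toQuot
  map_smul' _ _ := rfl
  map_zero' := rfl
  map_add' _ _ := rfl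
  map_mul' _ _ := rfl
  map_star' _ := rfl

end Quotient

section Maximal

variable {A : Type*} [NonUnitalCStarAlgebra A]

theorem eq_top_iff_forall {I : ClosedIdeal A} : I = ⊤ ↔ ∀ x, x ∈ I :=
  ⟨fun h _ => h ▸ trivial, fun h => top_le_iff.1 fun x _ => h x⟩

theorem lt_of_le_of_mem {I J : ClosedIdeal A} (h : I ≤ J) {x : A} (hJ : x ∈ J) (hI : x ∉ I) :
    I < J := lt_of_le_not_ge h fun h' => hI (h' hJ)

/-- A closed subset of `A` with the closure properties of an ideal, as a `ClosedIdeal`. -/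
def ofCarrier (s : Set A) (zero_mem : (0 : A) ∈ s) (add_mem : ∀ {x y}, x ∈ s → y ∈ s → x + y ∈ s)
    (neg_mem : ∀ {x}, x ∈ s → -x ∈ s) (mul_mem_left : ∀ {x y}, y ∈ s → x * y ∈ s)
    (mul_mem_right : ∀ {x y}, x ∈ s → x * y ∈ s) (isClosed : IsClosed s) : ClosedIdeal A where
  toTwoSidedIdeal := .mk' s zero_mem add_mem neg_mem mul_mem_left mul_mem_right
  isClosed' := by rwa [TwoSidedIdeal.coe_mk']

theorem mem_ofCarrier {s : Set A} {h₁ h₂ h₃ h₄ h₅ h₆} {x : A} :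
    x ∈ ofCarrier s h₁ h₂ h₃ h₄ h₅ h₆ ↔ x ∈ s := TwoSidedIdeal.mem_mk' s h₁ h₂ h₃ h₄ h₅ x

/-- The norm closure of a two-sided ideal. -/
def closure (I : TwoSidedIdeal A) : ClosedIdeal A :=
  ofCarrier (_root_.closure (I : Set A)) (subset_closure I.zero_mem)
    (fun hx hy => map_mem_closure₂ continuous_add hx hy fun _ ha _ hb => I.add_mem ha hb)
    (fun hx => map_mem_closure continuous_neg hx fun _ ha => I.neg_mem ha)
    (fun {x _} hy => map_mem_closure (f := fun z => x * z) (by fun_prop) hy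
      fun _ ha => I.mul_mem_left _ _ ha)
    (fun {_ y} hx => map_mem_closure (f := fun z => z * y) (by fun_prop) hx
      fun _ ha => I.mul_mem_right _ _ ha)
    isClosed_closure

theorem mem_closure {I : TwoSidedIdeal A} {x : A} :
    x ∈ closure I ↔ x ∈ _root_.closure (I : Set A) := mem_ofCarrier

/-- An ideal with a left modular unit `e` that has an element at distance less than one from `e`
is the whole algebra. -/
theorem mem_of_norm_sub_lt_one (I : TwoSidedIdeal A) {e : A} (he : ∀ a, e * a - a ∈ I) {x : A}
    (hx : x ∈ I) (h : ‖e - x‖ < 1) (b : A) : b ∈ I := by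
  let L : A →L[ℂ] A := ContinuousLinearMap.mul ℂ A (e - x)
  have hL : ‖L‖ < 1 := (ContinuousLinearMap.opNorm_mul_apply_le ℂ A _).trans_lt h
  let u := Units.oneSub L hL
  have hb : ((u : A →L[ℂ] A) * ((u⁻¹ : (A →L[ℂ] A)ˣ) : A →L[ℂ] A)) b = b := by
    rw [Units.mul_inv]; rfl
  have key : ∀ a, (u : A →L[ℂ] A) a ∈ I := fun a => by
    have : (u : A →L[ℂ] A) a = x * a - (e * a - a) := by
      change a - (e - x) * a = _
      noncomm_ring
    rw [this]
    exact I.sub_mem (I.mul_mem_right _ _ hx) (he a)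
  rw [← hb]
  exact key _

theorem quotMap_eq_iff {I : ClosedIdeal A} {a b : A} : I.quotMap a = I.quotMap b ↔ a - b ∈ I :=
  (RingCon.eq _).trans (TwoSidedIdeal.rel_iff _ _ _)

theorem quotMap_surjective (I : ClosedIdeal A) : Function.Surjective I.quotMap :=
  Quotient.mk_surjective

theorem isModular_iff {I : ClosedIdeal A} :
    I.IsModular ↔ ∃ e : A, ∀ a, e * a - a ∈ I ∧ a * e - a ∈ I := by
  unfold IsModular
  rw [I.quotMap_surjective.exists]
  refine exists_congr fun e => ?_
  rw [I.quotMap_surjective.forall]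
  refine forall_congr' fun a => ?_
  rw [← quotMap_eq_iff, ← quotMap_eq_iff]
  rfl

theorem unit_notMem {M : ClosedIdeal A} (hM : M ≠ ⊤) {e : A} (he : ∀ a, e * a - a ∈ M) :
    e ∉ M := fun h => hM <| eq_top_iff_forall.2 fun a => by
  have := sub_mem (M.mul_mem_right a h) (he a)
  rwa [sub_sub_cancel] at this

/-- An ideal not contained in a modular maximal ideal `M` contains a unit modulo `M`. -/
theorem exists_mem_unit {M : ClosedIdeal A} (hM : M ∈ MaxIdeals A) {J : ClosedIdeal A}
    (hJ : ¬ J ≤ M) : ∃ j ∈ J, ∀ a, j * a - a ∈ M ∧ a * j - a ∈ M := by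
  obtain ⟨e, he⟩ := isModular_iff.1 hM.2
  obtain ⟨x, hxJ, hxM⟩ := Set.not_subset.1 hJ
  let S : TwoSidedIdeal A := M.toTwoSidedIdeal ⊔ J.toTwoSidedIdeal
  have hMS : ∀ y ∈ M, y ∈ S := fun y hy => TwoSidedIdeal.mem_sup_left hy
  have hlt : M < closure S := lt_of_le_of_mem
    (fun y hy => mem_closure.2 (subset_closure (hMS y hy)))
    (mem_closure.2 (subset_closure (TwoSidedIdeal.mem_sup_right hxJ))) hxM
  have htop := hM.1.2 _ hlt
  have hecl : e ∈ closure S := htop ▸ trivial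
  obtain ⟨y, hyS, hy⟩ := Metric.mem_closure_iff.1 (mem_closure.1 hecl) 1 one_pos
  rw [dist_eq_norm] at hy
  have heS := mem_of_norm_sub_lt_one S (fun a => hMS _ (he a).1) hyS hy e
  obtain ⟨m, hm, j, hj, hmj⟩ := TwoSidedIdeal.mem_sup.1 heS
  refine ⟨j, hj, fun a => ⟨?_, ?_⟩⟩
  · have : j * a - a = (e * a - a) - m * a := by rw [← hmj]; noncomm_ring
    rw [this]; exact sub_mem (he a).1 (M.mul_mem_right _ hm)
  · have : a * j - a = (a * e - a) - a * m := by rw [← hmj]; noncomm_ring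
    rw [this]; exact sub_mem (he a).2 (M.mul_mem_left _ hm)

theorem eq_of_le_of_mem_maxIdeals {M N : ClosedIdeal A} (hM : M ∈ MaxIdeals A)
    (hN : N ∈ MaxIdeals A) (h : M ≤ N) : M = N :=
  h.eq_of_not_lt fun hlt => hN.1.1 (hM.1.2 _ hlt)

/-- A proper closed ideal with a modular unit is contained in a modular maximal ideal. -/
theorem exists_le_maxIdeal {J : ClosedIdeal A} (hJ : J ≠ ⊤) {e : A}
    (he : ∀ a, e * a - a ∈ J ∧ a * e - a ∈ J) : ∃ M ∈ MaxIdeals A, J ≤ M := by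
  obtain ⟨M, hJM, hM⟩ := zorn_le_nonempty₀ {I : ClosedIdeal A | J ≤ I ∧ I ≠ ⊤} (by
    intro c hc hchain K hK
    have hne : c.Nonempty := ⟨K, hK⟩
    have hdir : ∀ x y, (∃ I ∈ c, x ∈ I) → (∃ I ∈ c, y ∈ I) → ∃ I ∈ c, x ∈ I ∧ y ∈ I := by
      rintro x y ⟨I, hI, hx⟩ ⟨I', hI', hy⟩
      rcases hchain.total hI hI' with h | h
      · exact ⟨I', hI', h hx, hy⟩
      · exact ⟨I, hI, hx, h hy⟩
    let U : TwoSidedIdeal A := .mk' {x | ∃ I ∈ c, x ∈ I} ⟨K, hK, zero_mem K⟩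
      (fun {x y} hx hy => by
        obtain ⟨I, hI, hx, hy⟩ := hdir x y hx hy
        exact ⟨I, hI, add_mem hx hy⟩)
      (fun {x} ⟨I, hI, hx⟩ => ⟨I, hI, neg_mem hx⟩)
      (fun {x y} ⟨I, hI, hy⟩ => ⟨I, hI, I.mul_mem_left _ hy⟩)
      (fun {x y} ⟨I, hI, hx⟩ => ⟨I, hI, I.mul_mem_right _ hx⟩)
    have hU : ∀ x, x ∈ U ↔ ∃ I ∈ c, x ∈ I := fun x => TwoSidedIdeal.mem_mk' ..
    refine ⟨closure U, ⟨fun x hx => ?_, fun htop => ?_⟩, fun I hI x hx => ?_⟩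
    · exact mem_closure.2 (subset_closure ((hU x).2 ⟨K, hK, (hc hK).1 hx⟩))
    · have hecl : e ∈ closure U := htop ▸ trivial
      obtain ⟨y, hyU, hy⟩ := Metric.mem_closure_iff.1 (mem_closure.1 hecl) 1 one_pos
      rw [dist_eq_norm] at hy
      obtain ⟨I, hI, hyI⟩ := (hU y).1 hyU
      exact (hc hI).2 (eq_top_iff_forall.2 (mem_of_norm_sub_lt_one I.toTwoSidedIdeal
        (fun a => (hc hI).1 (he a).1) hyI hy))
    · exact mem_closure.2 (subset_closure ((hU x).2 ⟨I, hI, hx⟩))) J ⟨le_rfl, hJ⟩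
  refine ⟨M, ⟨⟨hM.prop.2, fun I hI => ?_⟩, isModular_iff.2 ⟨e, fun a => ?_⟩⟩, hJM⟩
  · by_contra hne
    exact hI.not_ge (hM.le_of_ge ⟨hJM.trans hI.le, hne⟩ hI.le)
  · exact ⟨hJM (he a).1, hJM (he a).2⟩

/-- The preimage in `A` of an ideal of `A / I`. -/
def comap (I : ClosedIdeal A) (P : ClosedIdeal I.CStarQuot) : ClosedIdeal A :=
  ofCarrier (I.toQuot ⁻¹' P) (zero_mem P) (fun hx hy => add_mem (S := ClosedIdeal I.CStarQuot) hx hy)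
    (fun hx => neg_mem (S := ClosedIdeal I.CStarQuot) hx)
    (fun {x _} hy => P.mul_mem_left (I.toQuot x) hy)
    (fun {_ y} hx => P.mul_mem_right (I.toQuot y) hx)
    (P.isClosed'.preimage (AddMonoidHomClass.continuous_of_bound I.quotHom 1 fun a => by
      rw [one_mul]; exact I.norm_toQuot_le a))

theorem mem_comap {I : ClosedIdeal A} {P : ClosedIdeal I.CStarQuot} {a : A} :
    a ∈ I.comap P ↔ I.toQuot a ∈ P := mem_ofCarrier

theorem le_comap (I : ClosedIdeal A) (P : ClosedIdeal I.CStarQuot) : I ≤ I.comap P :=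
  fun a ha => mem_comap.2 (by rw [I.toQuot_eq_zero.2 ha]; exact zero_mem P)

theorem comap_mem_maxIdeals {I : ClosedIdeal A} {P : ClosedIdeal I.CStarQuot}
    (hP : P ∈ MaxIdeals I.CStarQuot) : I.comap P ∈ MaxIdeals A := by
  obtain ⟨e', he'⟩ := isModular_iff.1 hP.2
  obtain ⟨e, rfl⟩ := I.toQuot_surjective e'
  have he : ∀ a, e * a - a ∈ I.comap P ∧ a * e - a ∈ I.comap P := fun a =>
    ⟨mem_comap.2 (he' (I.toQuot a)).1, mem_comap.2 (he' (I.toQuot a)).2⟩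
  refine ⟨⟨fun h => ?_, fun N hN => ?_⟩, isModular_iff.2 ⟨e, he⟩⟩
  · exact unit_notMem hP.1.1 (fun x => (he' x).1) (mem_comap.1 (h ▸ trivial : e ∈ I.comap P))
  · obtain ⟨n, hnN, hnP⟩ := Set.not_subset.1 hN.not_ge
    have hsat : ∀ a, I.toQuot a ∈ I.toQuot '' (N : Set A) → a ∈ N := by
      rintro a ⟨b, hb, hab⟩
      have h1 : b - a ∈ N := hN.le (I.le_comap P ((I.toQuot_eq_iff).1 hab))
      have := sub_mem hb h1
      rwa [sub_sub_cancel] at this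
    let N' : ClosedIdeal I.CStarQuot := ofCarrier (I.toQuot '' (N : Set A)) ⟨0, zero_mem N, rfl⟩
      (by rintro _ _ ⟨a, ha, rfl⟩ ⟨b, hb, rfl⟩; exact ⟨a + b, add_mem ha hb, rfl⟩)
      (by rintro _ ⟨a, ha, rfl⟩; exact ⟨-a, neg_mem ha, rfl⟩)
      (by
        rintro x _ ⟨a, ha, rfl⟩
        obtain ⟨b, rfl⟩ := I.toQuot_surjective x
        exact ⟨b * a, N.mul_mem_left _ ha, rfl⟩)
      (by
        rintro _ x ⟨a, ha, rfl⟩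
        obtain ⟨b, rfl⟩ := I.toQuot_surjective x
        exact ⟨a * b, N.mul_mem_right _ ha, rfl⟩)
      (by
        have hq : IsQuotientMap I.toQuot := I.toSubmodule.isQuotientMap_mkQ
        rw [← hq.isClosed_preimage]
        convert N.isClosed' using 1
        ext a
        exact ⟨hsat a, fun h => ⟨a, h, rfl⟩⟩)
    have hlt : P < N' := lt_of_le_of_mem (x := I.toQuot n) (fun x hx => by
        obtain ⟨a, rfl⟩ := I.toQuot_surjective x
        exact mem_ofCarrier.2 ⟨a, hN.le (mem_comap.2 hx), rfl⟩)
      (mem_ofCarrier.2 ⟨n, hnN, rfl⟩) fun h => hnP (mem_comap.2 h)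
    have htop := hP.1.2 _ hlt
    exact eq_top_iff_forall.2 fun a =>
      hsat a (mem_ofCarrier.1 (htop ▸ trivial : I.toQuot a ∈ N'))

end Maximal

end ClosedIdeal

section CQ

variable {A : Type*} [NonUnitalCStarAlgebra A]

theorem quotMap_mem_center_iff {I : ClosedIdeal A} {a : A} :
    I.quotMap a ∈ Set.center I.QuotAlg ↔ ∀ b, b * a - a * b ∈ I := by
  rw [Semigroup.mem_center_iff, I.quotMap_surjective.forall]
  refine forall_congr' fun b => ?_
  rw [← ClosedIdeal.quotMap_eq_iff]
  rfl

theorem hasCQProperty_iff : HasCQProperty A ↔ ∀ (I : ClosedIdeal A) (a : A),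
    (∀ b, b * a - a * b ∈ I) → ∃ z ∈ Set.center A, z - a ∈ I := by
  refine forall_congr' fun I => ?_
  rw [Set.Subset.antisymm_iff]
  have h : I.quotMap '' Set.center A ⊆ Set.center I.QuotAlg := by
    rintro _ ⟨z, hz, rfl⟩
    rw [quotMap_mem_center_iff]
    intro b
    rw [Semigroup.mem_center_iff.1 hz b, sub_self]
    exact zero_mem I
  refine ⟨fun hI a ha => ?_, fun hI => ⟨h, fun x hx => ?_⟩⟩
  · obtain ⟨z, hz, hza⟩ := hI.2 (quotMap_mem_center_iff.2 ha)
    exact ⟨z, hz, ClosedIdeal.quotMap_eq_iff.1 hza⟩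
  · obtain ⟨a, rfl⟩ := I.quotMap_surjective x
    obtain ⟨z, hz, hza⟩ := hI a (quotMap_mem_center_iff.1 hx)
    exact ⟨z, hz, ClosedIdeal.quotMap_eq_iff.2 hza⟩

theorem HasCQProperty.isWeaklyCentral (h : HasCQProperty A) : IsWeaklyCentral A := by
  rw [hasCQProperty_iff] at h
  refine ⟨fun M hM hZ => ?_, fun M₁ h₁ M₂ h₂ h₁₂ => ?_⟩
  · obtain ⟨e, he⟩ := ClosedIdeal.isModular_iff.1 hM.2
    obtain ⟨z, hz, hze⟩ := h M e fun b => by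
      simpa using sub_mem (he b).2 (he b).1
    refine ClosedIdeal.unit_notMem hM.1.1 (fun a => (he a).1) ?_
    simpa using sub_mem (hZ hz) hze
  · by_contra hne
    have hnle : ¬ M₂ ≤ M₁ := fun hle =>
      hne (ClosedIdeal.eq_of_le_of_mem_maxIdeals h₂ h₁ hle).symm
    obtain ⟨u, hu, hu1⟩ := ClosedIdeal.exists_mem_unit h₁ hnle
    let I : ClosedIdeal A := ClosedIdeal.ker {M₁, M₂}
    have hI : ∀ x, x ∈ I ↔ x ∈ M₁ ∧ x ∈ M₂ := fun x => by simp [I, ClosedIdeal.mem_ker]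
    obtain ⟨z, hz, hzu⟩ := h I u fun b => by
      rw [hI]
      refine ⟨by simpa using sub_mem (hu1 b).2 (hu1 b).1, ?_⟩
      exact sub_mem (M₂.mul_mem_left _ hu) (M₂.mul_mem_right _ hu)
    rw [hI] at hzu
    have hz2 : z ∈ M₂ := by simpa using add_mem hzu.2 hu
    have hz1 : z ∈ M₁ := (h₁₂.symm ▸ ⟨hz2, hz⟩ : z ∈ (M₁ : Set A) ∩ Set.center A).1
    refine ClosedIdeal.unit_notMem h₁.1.1 (fun a => (hu1 a).1) ?_
    simpa using sub_mem hz1 hzu.1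

end CQ

section Character

variable {Z B : Type*} [NonUnitalCStarAlgebra Z] [NonUnitalCStarAlgebra B]

theorem continuous_starHom (φ : Z →⋆ₙₐ[ℂ] B) : Continuous φ :=
  AddMonoidHomClass.continuous_of_bound φ 1 fun a => by
    rw [one_mul]; exact NonUnitalStarAlgHom.norm_apply_le φ a

theorem map_cfcₙ_complex (χ : Z →⋆ₙₐ[ℂ] ℂ) {f : ℝ → ℝ} (hf : Continuous f) (hf0 : f 0 = 0) {a : Z}
    (ha : IsSelfAdjoint a) {t : ℝ} (hat : χ a = t) : χ (cfcₙ f a) = f t := by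
  have h1 : χ (cfcₙ f a) = cfcₙ f (χ a) :=
    NonUnitalStarAlgHomClass.map_cfcₙ χ f a hf.continuousOn hf0 (continuous_starHom χ) ha (ha.map χ)
  rw [h1, hat, cfcₙ_eq_cfc hf.continuousOn hf0]
  exact cfc_algebraMap (A := ℂ) t f

/-- A character whose kernel contains the kernel of a ⋆-homomorphism `φ` is dominated by `φ`. -/
theorem norm_character_le (φ : Z →⋆ₙₐ[ℂ] B) (χ : Z →⋆ₙₐ[ℂ] ℂ) (h : ∀ z, φ z = 0 → χ z = 0)
    (z : Z) : ‖χ z‖ ≤ ‖φ z‖ := by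
  have key : ∀ a : Z, IsSelfAdjoint a → ∀ t : ℝ, χ a = t → t ≤ ‖φ a‖ := by
    intro a ha t hat
    let f : ℝ → ℝ := fun x => max (x - ‖φ a‖) 0
    have hf : Continuous f := by fun_prop
    have hf0 : f 0 = 0 := by simp [f]
    have h1 : φ (cfcₙ f a) = 0 := by
      rw [NonUnitalStarAlgHomClass.map_cfcₙ φ f a hf.continuousOn hf0 (continuous_starHom φ) ha (ha.map φ)]
      rw [← cfcₙ_zero ℝ (φ a)]
      refine cfcₙ_congr fun x hx => ?_
      have := norm_apply_le_norm_cfcₙ (fun x : ℝ => x) (φ a) hx (ha := ha.map φ)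
      rw [cfcₙ_id' ℝ (φ a) (ha.map φ)] at this
      have := (le_abs_self x).trans this
      simpa [f] using this
    have h2 := h _ h1
    rw [map_cfcₙ_complex χ hf hf0 ha hat] at h2
    have h3 : f t = 0 := by exact_mod_cast h2
    simpa [f] using h3
  have h1 := key (star z * z) (.star_mul_self z) (‖χ z‖ ^ 2) (by
    rw [map_mul, map_star, RCLike.star_def, RCLike.conj_mul]; norm_cast)
  rw [map_mul, map_star, CStarRing.norm_star_mul_self, ← sq] at h1
  exact (sq_le_sq₀ (norm_nonneg _) (norm_nonneg _)).1 h1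

/-- A truncation of a self-adjoint element `p` by the functional calculus. -/
theorem exists_truncation [PartialOrder Z] [StarOrderedRing Z] {p : Z} (hsa : IsSelfAdjoint p)
    {s : ℝ} (hs : 0 < s) : ∃ f : Z, star f = f ∧ ‖f‖ ≤ 1 ∧ 0 ≤ f * p * f ∧
      ∀ χ : Z →⋆ₙₐ[ℂ] ℂ, χ p = s → χ f = 1 := by
  let g : ℝ → ℝ := fun x => max (min (x / s) 1) 0
  have hg : Continuous g := by fun_prop
  have hg0 : g 0 = 0 := by simp [g]
  have hgn : ∀ x, 0 ≤ g x := fun x => le_max_right _ _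
  have hg1 : ∀ x, g x ≤ 1 := fun x => max_le (min_le_right _ _) zero_le_one
  have hgx : ∀ x, 0 ≤ g x * x * g x := fun x => by
    rcases le_or_gt 0 x with hx | hx
    · exact mul_nonneg (mul_nonneg (hgn x) hx) (hgn x)
    · have : g x = 0 := max_eq_right
        ((min_le_left _ _).trans (div_nonpos_of_nonpos_of_nonneg hx.le hs.le))
      simp [this]
  have hgs : g s = 1 := by simp [g, hs.ne']
  clear_value g
  have hmul : cfcₙ g p * p * cfcₙ g p = cfcₙ (fun x => g x * x * g x) p := by
    rw [cfcₙ_mul (fun x => g x * x) g p (by fun_prop) (by simp) (by fun_prop) hg0,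
      cfcₙ_mul g (fun x => x) p (by fun_prop) hg0 (by fun_prop) rfl, cfcₙ_id' ℝ p]
  refine ⟨cfcₙ g p, (cfcₙ_predicate g p : IsSelfAdjoint _).star_eq, norm_cfcₙ_le fun x _ => ?_, ?_,
    fun χ hχ => ?_⟩
  · rw [Real.norm_of_nonneg (hgn x)]; exact hg1 x
  · rw [hmul]; exact cfcₙ_nonneg fun x _ => hgx x
  · rw [map_cfcₙ_complex χ hg hg0 hsa hχ, hgs, Complex.ofReal_one]

/-- The kernel of a character can be annihilated up to `ε` by contractions on which the character
takes the value one. -/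
theorem exists_contraction_character_eq_one (χ : Z →⋆ₙₐ[ℂ] ℂ) (hχ : χ ≠ 0) {w : Z} (hw : χ w = 0)
    {ε : ℝ} (hε : 0 < ε) : ∃ f : Z, χ f = 1 ∧ ‖f‖ ≤ 1 ∧ ‖w * f‖ < ε := by
  let _ := CStarAlgebra.spectralOrder Z
  let _ := CStarAlgebra.spectralOrderedRing Z
  obtain ⟨u, hu⟩ : ∃ u, χ u ≠ 0 := by
    by_contra! hall
    exact hχ (NonUnitalStarAlgHom.ext hall)
  obtain ⟨s, hs, h, hhsa, hχh⟩ : ∃ s : ℝ, 0 < s ∧ ∃ h : Z, IsSelfAdjoint h ∧ χ h = s :=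
    ⟨‖χ u‖ ^ 2, by positivity, star u * u, .star_mul_self u, by
      rw [map_mul, map_star, RCLike.star_def, RCLike.conj_mul]; norm_cast⟩
  obtain ⟨c, hc, hch⟩ : ∃ c : ℝ, 0 < c ∧ ‖h‖ < c ^ 2 * ε ^ 2 := by
    refine ⟨√(‖h‖ + 1) / ε, by positivity, ?_⟩
    rw [← mul_pow, div_mul_cancel₀ _ hε.ne', Real.sq_sqrt (by positivity)]
    linarith
  set v : Z := (c : ℂ) • w
  have hχv : χ v = 0 := by rw [map_smul, hw, smul_zero]
  have hsa : IsSelfAdjoint (h - star v * v) := hhsa.sub (.star_mul_self v)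
  obtain ⟨f, hfs, hf1, hpos, hχf⟩ := exists_truncation hsa hs
  have hle : star (v * f) * (v * f) ≤ f * h * f := by
    have : f * (h - star v * v) * f = f * h * f - star (v * f) * (v * f) := by
      simp only [star_mul, hfs, mul_sub, sub_mul, mul_assoc]
    rw [this] at hpos
    exact sub_nonneg.1 hpos
  have hn := CStarAlgebra.norm_le_norm_of_nonneg_of_le (star_mul_self_nonneg _) hle
  rw [CStarRing.norm_star_mul_self, ← sq] at hn
  have hvn : ‖v * f‖ = c * ‖w * f‖ := by
    rw [smul_mul_assoc, norm_smul, Complex.norm_real, Real.norm_of_nonneg hc.le]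
  have hn2 : ‖f * h * f‖ ≤ ‖h‖ := by
    calc ‖f * h * f‖ ≤ ‖f‖ * ‖h‖ * ‖f‖ :=
          (norm_mul_le _ _).trans (by gcongr; exact norm_mul_le _ _)
      _ ≤ 1 * ‖h‖ * 1 := by gcongr
      _ = ‖h‖ := by ring
  refine ⟨f, hχf χ (by rw [map_sub, map_mul, hχv, mul_zero, sub_zero, hχh]), hf1, ?_⟩
  rw [hvn] at hn
  have h3 : (c * ‖w * f‖) ^ 2 < (c * ε) ^ 2 := by
    rw [mul_pow c ε]; exact (hn.trans hn2).trans_lt hch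
  exact lt_of_mul_lt_mul_left (lt_of_pow_lt_pow_left₀ 2 (by positivity) h3) hc.le

/-- Lying over: a character of `Z` that factors through a ⋆-homomorphism `φ` into the centre of `B`
is induced by a modular maximal ideal of `B`. -/
theorem exists_maxIdeal_over (φ : Z →⋆ₙₐ[ℂ] B) (hφ : ∀ z b, b * φ z = φ z * b)
    (χ : Z →⋆ₙₐ[ℂ] ℂ) (hχ : χ ≠ 0) (h : ∀ z, φ z = 0 → χ z = 0) :
    ∃ P ∈ MaxIdeals B, ∀ z, φ z ∈ P ↔ χ z = 0 := by
  have hφn : ∀ z, ‖φ z‖ ≤ ‖z‖ := NonUnitalStarAlgHom.norm_apply_le φ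
  obtain ⟨f₀, hf₀, hf₀n, -⟩ :=
    exists_contraction_character_eq_one χ hχ (w := 0) (map_zero χ) one_pos
  let J : ClosedIdeal B := ClosedIdeal.ofCarrier
    {b | ∀ ε > 0, ∃ f : Z, χ f = 1 ∧ ‖f‖ ≤ 1 ∧ ‖φ f * b‖ < ε}
    (fun ε hε => ⟨f₀, hf₀, hf₀n, by simpa using hε⟩)
    (by
      intro x y hx hy ε hε
      obtain ⟨f, hf1, hfn, hf⟩ := hx (ε / 2) (half_pos hε)
      obtain ⟨g, hg1, hgn, hg⟩ := hy (ε / 2) (half_pos hε)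
      refine ⟨f * g, by rw [map_mul, hf1, hg1, one_mul],
        (norm_mul_le _ _).trans (mul_le_one₀ hfn (norm_nonneg _) hgn), ?_⟩
      have : φ (f * g) * (x + y) = φ g * (φ f * x) + φ f * (φ g * y) := by
        rw [map_mul, mul_add, ← mul_assoc (φ g), hφ f (φ g), mul_assoc _ _ y]
      rw [this]
      calc _ ≤ ‖φ g * (φ f * x)‖ + ‖φ f * (φ g * y)‖ := norm_add_le _ _
        _ ≤ ‖φ g‖ * ‖φ f * x‖ + ‖φ f‖ * ‖φ g * y‖ := by gcongr <;> exact norm_mul_le _ _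
        _ ≤ 1 * ‖φ f * x‖ + 1 * ‖φ g * y‖ := by
          gcongr
          · exact (hφn g).trans hgn
          · exact (hφn f).trans hfn
        _ < ε := by linarith)
    (by
      intro x hx ε hε
      obtain ⟨f, hf1, hfn, hf⟩ := hx ε hε
      exact ⟨f, hf1, hfn, by rwa [mul_neg, norm_neg]⟩)
    (by
      intro x y hy ε hε
      obtain ⟨f, hf1, hfn, hf⟩ := hy (ε / (‖x‖ + 1)) (by positivity)
      refine ⟨f, hf1, hfn, ?_⟩
      rw [← mul_assoc, ← hφ, mul_assoc]
      calc _ ≤ ‖x‖ * ‖φ f * y‖ := norm_mul_le _ _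
        _ ≤ (‖x‖ + 1) * ‖φ f * y‖ := by gcongr; linarith
        _ < (‖x‖ + 1) * (ε / (‖x‖ + 1)) := by gcongr
        _ = ε := by field_simp)
    (by
      intro y x hy ε hε
      obtain ⟨f, hf1, hfn, hf⟩ := hy (ε / (‖x‖ + 1)) (by positivity)
      refine ⟨f, hf1, hfn, ?_⟩
      rw [← mul_assoc]
      calc _ ≤ ‖φ f * y‖ * ‖x‖ := norm_mul_le _ _
        _ ≤ ‖φ f * y‖ * (‖x‖ + 1) := by gcongr; linarith
        _ < (ε / (‖x‖ + 1)) * (‖x‖ + 1) := by gcongr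
        _ = ε := by field_simp)
    (by
      refine isClosed_of_closure_subset fun b hb ε hε => ?_
      obtain ⟨c, hc, hbc⟩ := Metric.mem_closure_iff.1 hb (ε / 2) (half_pos hε)
      obtain ⟨f, hf1, hfn, hf⟩ := hc (ε / 2) (half_pos hε)
      refine ⟨f, hf1, hfn, ?_⟩
      rw [dist_eq_norm] at hbc
      have : φ f * b = φ f * (b - c) + φ f * c := by noncomm_ring
      rw [this]
      calc _ ≤ ‖φ f * (b - c)‖ + ‖φ f * c‖ := norm_add_le _ _
        _ ≤ ‖φ f‖ * ‖b - c‖ + ‖φ f * c‖ := by gcongr; exact norm_mul_le _ _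
        _ ≤ 1 * ‖b - c‖ + ‖φ f * c‖ := by gcongr; exact (hφn f).trans hfn
        _ < ε := by linarith)
  have hJ : ∀ b, b ∈ J ↔ ∀ ε > 0, ∃ f : Z, χ f = 1 ∧ ‖f‖ ≤ 1 ∧ ‖φ f * b‖ < ε :=
    fun b => ClosedIdeal.mem_ofCarrier
  have hker : ∀ w, χ w = 0 → φ w ∈ J := fun w hw => (hJ _).2 fun ε hε => by
    obtain ⟨f, hf1, hfn, hf⟩ := exists_contraction_character_eq_one χ hχ hw hε
    refine ⟨f, hf1, hfn, ?_⟩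
    rw [← hφ, ← map_mul]
    exact (hφn _).trans_lt hf
  have hunit : ∀ e, χ e = 1 → ∀ b, φ e * b - b ∈ J := fun e he b => (hJ _).2 fun ε hε => by
    obtain ⟨f, hf1, hfn, hf⟩ := exists_contraction_character_eq_one χ hχ
      (w := e * f₀ - f₀) (by simp [he]) (ε := ε / (‖b‖ + 1)) (by positivity)
    refine ⟨f₀ * f, by rw [map_mul, hf₀, hf1, one_mul],
      (norm_mul_le _ _).trans (mul_le_one₀ hf₀n (norm_nonneg _) hfn), ?_⟩
    have : φ (f₀ * f) * (φ e * b - b) = φ ((e * f₀ - f₀) * f) * b := by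
      simp only [map_mul, map_sub, mul_sub, sub_mul, ← mul_assoc]
      rw [hφ e (φ f₀ * φ f), ← mul_assoc (φ e)]
    rw [this]
    calc _ ≤ ‖φ ((e * f₀ - f₀) * f)‖ * ‖b‖ := norm_mul_le _ _
      _ ≤ ‖φ ((e * f₀ - f₀) * f)‖ * (‖b‖ + 1) := by gcongr; linarith
      _ < (ε / (‖b‖ + 1)) * (‖b‖ + 1) := by gcongr; exact (hφn _).trans_lt hf
      _ = ε := by field_simp
  have htop : J ≠ ⊤ := fun htop => by
    obtain ⟨f, hf1, -, hf⟩ := (hJ (φ f₀)).1 (htop ▸ trivial) 1 one_pos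
    rw [← map_mul] at hf
    have := (norm_character_le φ χ h (f * f₀)).trans_lt hf
    simp [hf1, hf₀] at this
  obtain ⟨P, hP, hJP⟩ := ClosedIdeal.exists_le_maxIdeal htop (e := φ f₀) fun a =>
    ⟨hunit f₀ hf₀ a, by rw [hφ]; exact hunit f₀ hf₀ a⟩
  refine ⟨P, hP, fun z => ⟨fun hz => ?_, fun hz => hJP (hker z hz)⟩⟩
  by_contra hne
  refine ClosedIdeal.unit_notMem hP.1.1 (e := φ ((χ z)⁻¹ • z)) (fun a => hJP (hunit _ ?_ a)) ?_
  · rw [map_smul, smul_eq_mul, inv_mul_cancel₀ hne]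
  · rw [map_smul]; exact P.smul_mem _ hz

end Character

section Surjective

variable {Z W : Type*} [NonUnitalCStarAlgebra Z]

theorem exists_norm_le_of_isSelfAdjoint [NonUnitalCStarAlgebra W] (φ : Z →⋆ₙₐ[ℂ] W) {a : Z}
    (ha : IsSelfAdjoint a) : ∃ b : Z, φ b = φ a ∧ ‖b‖ ≤ ‖φ a‖ := by
  let f : ℝ → ℝ := fun x => max (min x ‖φ a‖) (-‖φ a‖)
  have hf : Continuous f := by fun_prop
  have hf0 : f 0 = 0 := by simp [f]
  refine ⟨cfcₙ f a, ?_, norm_cfcₙ_le fun x _ => ?_⟩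
  · rw [NonUnitalStarAlgHomClass.map_cfcₙ φ f a hf.continuousOn hf0 (continuous_starHom φ) ha
      (ha.map φ)]
    conv_rhs => rw [← cfcₙ_id' ℝ (φ a) (ha.map φ)]
    refine cfcₙ_congr fun x hx => ?_
    have h := norm_apply_le_norm_cfcₙ (fun x : ℝ => x) (φ a) hx (ha := ha.map φ)
    rw [cfcₙ_id' ℝ (φ a) (ha.map φ), Real.norm_eq_abs, abs_le] at h
    simp only [f]
    rw [min_eq_left h.2, max_eq_left h.1]
  · rw [Real.norm_eq_abs, abs_le]
    exact ⟨le_max_right _ _, max_le (min_le_right _ _) (by linarith [norm_nonneg (φ a)])⟩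

theorem exists_norm_le_two_mul [NonUnitalCStarAlgebra W] (φ : Z →⋆ₙₐ[ℂ] W) (a : Z) :
    ∃ b : Z, φ b = φ a ∧ ‖b‖ ≤ 2 * ‖φ a‖ := by
  obtain ⟨x, hx, hxn⟩ := exists_norm_le_of_isSelfAdjoint φ (a := a + star a)
    (.add_star_self a)
  obtain ⟨y, hy, hyn⟩ := exists_norm_le_of_isSelfAdjoint φ (a := Complex.I • (a - star a)) (by
    rw [IsSelfAdjoint, star_smul, star_sub, star_star, RCLike.star_def, Complex.conj_I, neg_smul,
      ← smul_neg, neg_sub])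
  have h1 : ‖φ (a + star a)‖ ≤ 2 * ‖φ a‖ := by
    rw [map_add, map_star]
    exact (norm_add_le _ _).trans (by rw [norm_star]; linarith)
  have h2 : ‖φ (Complex.I • (a - star a))‖ ≤ 2 * ‖φ a‖ := by
    rw [map_smul, norm_smul, Complex.norm_I, one_mul, map_sub, map_star]
    exact (norm_sub_le _ _).trans (by rw [norm_star]; linarith)
  refine ⟨(1 / 2 : ℂ) • (x - Complex.I • y), ?_, ?_⟩
  · rw [map_smul, map_sub, map_smul, hx, hy, ← map_smul, ← map_sub, ← map_smul]
    congr 1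
    rw [smul_smul, Complex.I_mul_I, neg_one_smul, sub_neg_eq_add, add_add_sub_cancel, ← two_smul ℂ a,
      smul_smul]
    norm_num
  · rw [norm_smul]
    have h3 : ‖x - Complex.I • y‖ ≤ ‖x‖ + ‖y‖ := by
      refine (norm_sub_le _ _).trans ?_
      rw [norm_smul, Complex.norm_I, one_mul]
    have h4 : ‖(1 / 2 : ℂ)‖ = 1 / 2 := by simp
    rw [h4]
    linarith

/-- A ⋆-homomorphism between C⋆-algebras has closed range. -/
theorem isClosed_range_starHom [NonUnitalCStarAlgebra W] (φ : Z →⋆ₙₐ[ℂ] W) :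
    IsClosed (Set.range φ) := by
  let f : NormedAddGroupHom Z W := (AddMonoidHomClass.toAddMonoidHom φ).mkNormedAddGroupHom 1
    fun a => by rw [one_mul]; exact NonUnitalStarAlgHom.norm_apply_le φ a
  have hf : f.SurjectiveOnWith f.range 2 := by
    rintro _ ⟨a, rfl⟩
    exact exists_norm_le_two_mul φ a
  have h := controlled_closure_of_complete two_pos one_pos hf
  refine isClosed_of_closure_subset fun w hw => ?_
  obtain ⟨z, hz, -⟩ := h w hw
  exact ⟨z, hz⟩

/-- A ⋆-homomorphism into a commutative C⋆-algebra `W` whose range separates the characters of `W`,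
the zero functional included, is surjective. -/
theorem surjective_of_separates [NonUnitalCommCStarAlgebra W] (φ : Z →⋆ₙₐ[ℂ] W)
    (hsep : ∀ χ₁ χ₂ : W →⋆ₙₐ[ℂ] ℂ, (∀ z, χ₁ (φ z) = χ₂ (φ z)) → χ₁ = χ₂) :
    Function.Surjective φ := by
  intro w
  let G := gelfandStarTransform (Unitization ℂ W)
  let G' : Unitization ℂ W →⋆ₐ[ℂ] C(WeakDual.characterSpace ℂ (Unitization ℂ W), ℂ) :=
    StarAlgHomClass.toStarAlgHom G
  let S : StarSubalgebra ℂ (Unitization ℂ W) := (Unitization.starMap φ).range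
  have hS : (S.map G').SeparatesPoints := by
    intro x y hxy
    by_contra! hall
    refine hxy ?_
    have hchar : ∀ z, x (φ z : Unitization ℂ W) = y (φ z : Unitization ℂ W) := fun z =>
      hall (G (φ z : Unitization ℂ W)) ⟨G (φ z : Unitization ℂ W), ⟨_, ⟨(z : Unitization ℂ Z),
        Unitization.starMap_inr φ z⟩, rfl⟩, rfl⟩
    let X (x : WeakDual.characterSpace ℂ (Unitization ℂ W)) : Unitization ℂ W →⋆ₐ[ℂ] ℂ :=
      { WeakDual.CharacterSpace.toAlgHom x with map_star' := map_star x }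
    have hX : X x = X y := by
      refine Unitization.starLift.symm.injective (hsep _ _ hchar)
    ext a
    exact DFunLike.congr_fun hX a
  have hd := ContinuousMap.starSubalgebra_topologicalClosure_eq_top_of_separatesPoints _ hS
  have hG : Isometry G := gelfandTransform_isometry (Unitization ℂ W)
  have hcl : (w : Unitization ℂ W) ∈ closure (S : Set (Unitization ℂ W)) := by
    rw [hG.isUniformInducing.isInducing.closure_eq_preimage_closure_image]
    have : G (w : Unitization ℂ W) ∈
      (S.map G').topologicalClosure := hd ▸ trivial
    exact this
  have hw : w ∈ closure (Set.range φ) := by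
    refine map_mem_closure (f := fun x : Unitization ℂ W => x.snd) Unitization.continuous_snd hcl ?_
    rintro _ ⟨x, rfl⟩
    induction x with
    | inl_add_inr r z =>
      refine ⟨z, ?_⟩
      rw [map_add]
      simp [Unitization.algebraMap_eq_inl]
  rwa [(isClosed_range_starHom φ).closure_eq] at hw

end Surjective

section Centre

variable (A : Type*) [NonUnitalCStarAlgebra A]

/-- The centre of `A` as a ⋆-subalgebra. -/
abbrev Centre : NonUnitalStarSubalgebra ℂ A := NonUnitalStarSubalgebra.center ℂ A

theorem isClosed_centre : IsClosed (Centre A : Set A) := by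
  rw [NonUnitalStarSubalgebra.coe_center, ← Set.centralizer_univ]
  exact Set.isClosed_centralizer _

noncomputable instance : NonUnitalCommCStarAlgebra (Centre A) where
  __ := NonUnitalStarSubalgebra.nonUnitalCStarAlgebra (Centre A) (h_closed := isClosed_centre A)
  mul_comm := mul_comm

variable {A}

theorem mem_centre {z : A} : z ∈ Centre A ↔ z ∈ Set.center A := Iff.rfl

theorem centre_comm (z : Centre A) (a : A) : a * z = z * a := Semigroup.mem_center_iff.1 z.2 a

/-- The inclusion of the centre. -/
abbrev centreIncl : Centre A →⋆ₙₐ[ℂ] A := NonUnitalStarSubalgebraClass.subtype (Centre A)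

/-- The map induced by the quotient map on the centres. -/
noncomputable def centreMap (I : ClosedIdeal A) : Centre A →⋆ₙₐ[ℂ] Centre I.CStarQuot :=
  NonUnitalStarAlgHom.codRestrict (I.quotHom.comp centreIncl) (Centre I.CStarQuot) fun z =>
    mem_centre.2 <| Semigroup.mem_center_iff.2 fun x => by
      obtain ⟨a, rfl⟩ := I.toQuot_surjective x
      exact congrArg I.toQuot (centre_comm z a)

theorem exists_maxIdeal_over_centre (χ : Centre A →⋆ₙₐ[ℂ] ℂ) (hχ : χ ≠ 0) :
    ∃ P ∈ MaxIdeals A, ∀ z : Centre A, (z : A) ∈ P ↔ χ z = 0 :=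
  exists_maxIdeal_over centreIncl centre_comm χ hχ fun z hz => by
    have : z = 0 := Subtype.ext hz
    rw [this, map_zero]

theorem character_ext_of_ker_le {W : Type*} [NonUnitalCStarAlgebra W] {χ₁ χ₂ : W →⋆ₙₐ[ℂ] ℂ}
    (hker : ∀ w, χ₁ w = 0 → χ₂ w = 0) {e : W} (he : χ₁ e ≠ 0) (h : χ₁ e = χ₂ e) : χ₁ = χ₂ := by
  refine NonUnitalStarAlgHom.ext fun w => ?_
  have hw := hker (w - (χ₁ w / χ₁ e) • e) (by
    rw [map_sub, map_smul, smul_eq_mul, div_mul_cancel₀ _ he, sub_self])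
  rw [map_sub, map_smul, smul_eq_mul, ← h, div_mul_cancel₀ _ he, sub_eq_zero] at hw
  exact hw.symm

theorem IsWeaklyCentral.hasCQProperty (h : IsWeaklyCentral A) : HasCQProperty A := by
  rw [hasCQProperty_iff]
  intro I a ha
  have hne : ∀ χ : Centre I.CStarQuot →⋆ₙₐ[ℂ] ℂ, χ ≠ 0 → ∃ z, χ (centreMap I z) ≠ 0 := by
    intro χ hχ
    obtain ⟨P, hP, hPχ⟩ := exists_maxIdeal_over_centre χ hχ
    obtain ⟨z, hz, hzP⟩ := Set.not_subset.1 (h.1 _ (ClosedIdeal.comap_mem_maxIdeals hP))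
    exact ⟨⟨z, hz⟩, fun h0 => hzP (ClosedIdeal.mem_comap.2 ((hPχ _).2 h0))⟩
  have hsurj : Function.Surjective (centreMap I) := by
    refine surjective_of_separates _ fun χ₁ χ₂ h₁₂ => ?_
    by_cases h1 : χ₁ = 0
    · by_contra hcon
      obtain ⟨z, hz⟩ := hne χ₂ fun h2 => hcon (h1.trans h2.symm)
      rw [← h₁₂, h1] at hz
      exact hz rfl
    obtain ⟨e, he⟩ := hne χ₁ h1
    have h2 : χ₂ ≠ 0 := by
      rintro rfl
      rw [h₁₂] at he
      exact he rfl
    obtain ⟨P₁, hP₁, hPχ₁⟩ := exists_maxIdeal_over_centre χ₁ h1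
    obtain ⟨P₂, hP₂, hPχ₂⟩ := exists_maxIdeal_over_centre χ₂ h2
    have hPP : I.comap P₁ = I.comap P₂ := by
      refine h.2 _ (ClosedIdeal.comap_mem_maxIdeals hP₁) _ (ClosedIdeal.comap_mem_maxIdeals hP₂) ?_
      ext z
      refine and_congr_left fun hz => ?_
      have e1 := hPχ₁ (centreMap I ⟨z, hz⟩)
      have e2 := hPχ₂ (centreMap I ⟨z, hz⟩)
      rw [h₁₂] at e1
      exact ClosedIdeal.mem_comap.trans ((e1.trans e2.symm).trans ClosedIdeal.mem_comap.symm)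
    have hker : ∀ w, χ₁ w = 0 → χ₂ w = 0 := by
      intro w hw
      obtain ⟨b, hb⟩ := I.toQuot_surjective w
      have hb1 : b ∈ I.comap P₁ := ClosedIdeal.mem_comap.2 (hb ▸ (hPχ₁ w).2 hw)
      rw [hPP, ClosedIdeal.mem_comap, hb] at hb1
      exact (hPχ₂ w).1 hb1
    exact character_ext_of_ker_le hker he (h₁₂ e)
  have hac : I.toQuot a ∈ Centre I.CStarQuot :=
    mem_centre.2 <| Semigroup.mem_center_iff.2 fun x => by
      obtain ⟨b, rfl⟩ := I.toQuot_surjective x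
      exact I.toQuot_eq_iff.2 (ha b)
  obtain ⟨z, hz⟩ := hsurj ⟨_, hac⟩
  exact ⟨z, z.2, I.toQuot_eq_iff.1 (congrArg Subtype.val hz)⟩

end Centre

section GelfandMazur

theorem exists_sub_smul_not_invertible {B : Type*} [NonUnitalCStarAlgebra B] {e : B}
    (he : ∀ x, e * x = x ∧ x * e = x) (he0 : e ≠ 0) (x : B) :
    ∃ c : ℂ, ∀ y, (x - c • e) * y = e → y * (x - c • e) = e → False := by
  let _ : NormedRing B :=
    { (inferInstance : NonUnitalNormedRing B) with
      one := e
      one_mul := fun x => (he x).1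
      mul_one := fun x => (he x).2 }
  let _ : NormedAlgebra ℂ B :=
    { Algebra.ofModule (R := ℂ) (A := B) smul_mul_assoc mul_smul_comm with
      norm_smul_le := norm_smul_le }
  have _ : Nontrivial B := ⟨⟨e, 0, he0⟩⟩
  obtain ⟨c, hc⟩ := spectrum.nonempty x
  refine ⟨c, fun y h1 h2 => hc ?_⟩
  have hu : IsUnit (x - c • e) := ⟨⟨x - c • e, y, h1, h2⟩, rfl⟩
  have : algebraMap ℂ B c - x = -(x - c • e) := by
    rw [neg_sub]; rfl
  change IsUnit (algebraMap ℂ B c - x)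
  rw [this]
  exact hu.neg

variable {A : Type*} [NonUnitalCStarAlgebra A]

/-- Central elements are scalar modulo a modular maximal ideal. -/
theorem exists_sub_smul_mem {M : ClosedIdeal A} (hM : M ∈ MaxIdeals A) {e : A}
    (he : ∀ a, e * a - a ∈ M ∧ a * e - a ∈ M) {z : A} (hz : z ∈ Set.center A) :
    ∃ c : ℂ, z - c • e ∈ M := by
  have he' : ∀ x, M.toQuot e * x = x ∧ x * M.toQuot e = x := fun x => by
    obtain ⟨a, rfl⟩ := M.toQuot_surjective x
    exact ⟨M.toQuot_eq_iff.2 (he a).1, M.toQuot_eq_iff.2 (he a).2⟩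
  have he0 : M.toQuot e ≠ 0 := fun h =>
    ClosedIdeal.unit_notMem hM.1.1 (fun a => (he a).1) (M.toQuot_eq_zero.1 h)
  obtain ⟨c, hc⟩ := exists_sub_smul_not_invertible he' he0 (M.toQuot z)
  refine ⟨c, ?_⟩
  by_contra hcon
  set x := z - c • e
  have hcomm : ∀ b, b * x - x * b ∈ M := fun b => by
    have h1 : b * x - x * b = c • ((e * b - b) - (b * e - b)) := by
      simp only [x, mul_sub, sub_mul, mul_smul_comm, smul_mul_assoc, smul_sub,
        Semigroup.mem_center_iff.1 hz b]
      abel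
    rw [h1]
    exact M.smul_mem _ (sub_mem (he b).1 (he b).2)
  let D : TwoSidedIdeal A := .mk' {y | ∃ a, y - x * a ∈ M} ⟨0, by simp⟩
    (by
      rintro y y' ⟨a, ha⟩ ⟨a', ha'⟩
      refine ⟨a + a', ?_⟩
      rw [mul_add, add_sub_add_comm]
      exact add_mem ha ha')
    (by
      rintro y ⟨a, ha⟩
      refine ⟨-a, ?_⟩
      rw [mul_neg, neg_sub_neg, ← neg_sub]
      exact neg_mem ha)
    (by
      rintro b y ⟨a, ha⟩
      refine ⟨b * a, ?_⟩
      have : b * y - x * (b * a) = b * (y - x * a) + (b * x - x * b) * a := by noncomm_ring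
      rw [this]
      exact add_mem (M.mul_mem_left _ ha) (M.mul_mem_right _ (hcomm b)))
    (by
      rintro y b ⟨a, ha⟩
      refine ⟨a * b, ?_⟩
      rw [← mul_assoc, ← sub_mul]
      exact M.mul_mem_right _ ha)
  have hD : ∀ y, y ∈ D ↔ ∃ a, y - x * a ∈ M := fun y => TwoSidedIdeal.mem_mk' ..
  have hMD : ∀ y ∈ M, y ∈ D := fun y hy => (hD y).2 ⟨0, by simpa using hy⟩
  have hlt : M < ClosedIdeal.closure D := ClosedIdeal.lt_of_le_of_mem (x := x)
    (fun y hy => ClosedIdeal.mem_closure.2 (subset_closure (hMD y hy)))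
    (ClosedIdeal.mem_closure.2 (subset_closure ((hD x).2 ⟨e, by
      rw [← neg_sub]; exact neg_mem (he x).2⟩))) hcon
  have hecl : e ∈ ClosedIdeal.closure D := hM.1.2 _ hlt ▸ trivial
  obtain ⟨y, hyD, hy⟩ := Metric.mem_closure_iff.1 (ClosedIdeal.mem_closure.1 hecl) 1 one_pos
  rw [dist_eq_norm] at hy
  obtain ⟨a, ha⟩ := (hD e).1 (ClosedIdeal.mem_of_norm_sub_lt_one D
    (fun a => hMD _ (he a).1) hyD hy e)
  have h1 : M.toQuot (x * a) = M.toQuot e := (M.toQuot_eq_iff.2 ha).symm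
  refine hc (M.toQuot a) h1 ?_
  exact (M.toQuot_eq_iff.2 (hcomm a) : M.toQuot (a * x) = M.toQuot (x * a)).trans h1

/-- A modular maximal ideal induces a character of the centre. -/
theorem exists_character {M : ClosedIdeal A} (hM : M ∈ MaxIdeals A) :
    ∃ χ : Centre A →⋆ₙₐ[ℂ] ℂ, ∀ z : Centre A, χ z = 0 ↔ (z : A) ∈ M := by
  obtain ⟨e, he⟩ := ClosedIdeal.isModular_iff.1 hM.2
  have heM : e ∉ M := ClosedIdeal.unit_notMem hM.1.1 (fun a => (he a).1)
  have huniq : ∀ {c d : ℂ} {z : A}, z - c • e ∈ M → z - d • e ∈ M → c = d := by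
    intro c d z hc hd
    by_contra hne
    have h1 : (c - d) • e ∈ M := by
      have := sub_mem hd hc
      rwa [sub_sub_sub_cancel_left, ← sub_smul] at this
    have h2 := M.smul_mem (c - d)⁻¹ h1
    rw [smul_smul, inv_mul_cancel₀ (sub_ne_zero.2 hne), one_smul] at h2
    exact heM h2
  choose χ hχ using fun z : Centre A => exists_sub_smul_mem hM he z.2
  have hstar : star e - e ∈ M := by
    have h1 := (he (star e)).2
    have h2 := M.star_mem h1
    rw [star_sub, star_mul, star_star] at h2
    have := sub_mem h2 h1
    rwa [sub_sub_sub_cancel_left] at this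
  refine ⟨{ toFun := χ, map_smul' := ?_, map_zero' := ?_, map_add' := ?_, map_mul' := ?_,
            map_star' := ?_ }, fun z => ⟨fun h => ?_, fun h => ?_⟩⟩
  · intro c z
    refine huniq (hχ (c • z)) ?_
    have := M.smul_mem c (hχ z)
    rwa [smul_sub, smul_smul] at this
  · refine huniq (hχ 0) ?_
    simp
  · intro z w
    refine huniq (hχ (z + w)) ?_
    have := add_mem (hχ z) (hχ w)
    rwa [← add_sub_add_comm, ← add_smul] at this
  · intro z w
    refine huniq (hχ (z * w)) ?_
    have h : ((z * w : Centre A) : A) - (χ z * χ w) • e =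
        (z - χ z • e) * w + χ z • ((e * w - w) + (w - χ w • e)) := by
      rw [sub_mul, smul_mul_assoc, sub_add_sub_cancel, smul_sub, smul_smul, sub_add_sub_cancel]
      rfl
    rw [h]
    exact add_mem (M.mul_mem_right _ (hχ z)) (M.smul_mem _ (add_mem (he w).1 (hχ w)))
  · intro z
    refine huniq (hχ (star z)) ?_
    have h1 := M.star_mem (hχ z)
    rw [star_sub, star_smul] at h1
    have h2 := add_mem h1 (M.smul_mem (star (χ z)) hstar)
    rwa [smul_sub, sub_add_sub_cancel] at h2
  · have := hχ z
    have h0 : χ z = 0 := h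
    rwa [h0, zero_smul, sub_zero] at this
  · refine huniq (hχ z) ?_
    rwa [zero_smul, sub_zero]

end GelfandMazur

variable {A : Type*} [NonUnitalCStarAlgebra A]

namespace ClosedIdeal

/-- The centre of an ideal `J` of `A` is `J ∩ Z(A)`. -/
theorem coe_mem_center_iff {J : ClosedIdeal A} {z : J} :
    (z : A) ∈ Set.center A ↔ z ∈ Set.center J := by
  rw [Semigroup.mem_center_iff, Semigroup.mem_center_iff]
  refine ⟨fun h j => Subtype.ext (h j), fun h a => ?_⟩
  have hJ : ∀ j ∈ J, j * (z : A) = z * j := fun j hj => congrArg Subtype.val (h ⟨j, hj⟩)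
  set x := a * (z : A) - z * a
  have hx : x ∈ J := sub_mem (J.mul_mem_left _ z.2) (J.mul_mem_right _ z.2)
  have hxj : ∀ j ∈ J, x * j = 0 := fun j hj => by
    rw [sub_mul, mul_assoc, ← hJ j hj, mul_assoc, ← hJ _ (J.mul_mem_left a hj), mul_assoc, sub_self]
  exact sub_eq_zero.1 ((CStarRing.mul_star_self_eq_zero_iff x).1 (hxj _ (J.star_mem hx)))

/-- Ideals of an ideal absorb multiplication by all of `A`. -/
theorem mul_mem_of_mem {J : ClosedIdeal A} (N : ClosedIdeal J) {n : J} (hn : n ∈ N) (a : A) :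
    (⟨a * n, J.mul_mem_left a n.2⟩ : J) ∈ N := by
  have hcl : IsClosed (N : Set J) := N.isClosed'
  refine hcl.closure_subset (Metric.mem_closure_iff.2 fun ε hε => ?_)
  obtain ⟨e, heJ, -, -, -, he⟩ := J.exists_approx_unit n.2 (ε := ε / (‖a‖ + 1)) (by positivity)
  refine ⟨⟨a * e, J.mul_mem_left a heJ⟩ * n, N.mul_mem_left _ hn, ?_⟩
  rw [Subtype.dist_eq, dist_eq_norm]
  have : a * (n : A) - a * e * n = a * (n - e * n) := by noncomm_ring
  calc ‖a * (n : A) - a * e * n‖ ≤ ‖a‖ * ‖(n : A) - e * n‖ := by rw [this]; exact norm_mul_le _ _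
    _ ≤ (‖a‖ + 1) * ‖(n : A) - e * n‖ := by gcongr; linarith
    _ < (‖a‖ + 1) * (ε / (‖a‖ + 1)) := by gcongr
    _ = ε := by field_simp

/-- An ideal of an ideal of `A`, as an ideal of `A`. -/
noncomputable def ofIdeal {J : ClosedIdeal A} (N : ClosedIdeal J) : ClosedIdeal A :=
  ofCarrier ((↑) '' (N : Set J)) ⟨0, zero_mem N, rfl⟩
    (by rintro _ _ ⟨x, hx, rfl⟩ ⟨y, hy, rfl⟩; exact ⟨x + y, add_mem hx hy, rfl⟩)
    (by rintro _ ⟨x, hx, rfl⟩; exact ⟨-x, neg_mem hx, rfl⟩)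
    (by rintro a _ ⟨x, hx, rfl⟩; exact ⟨_, mul_mem_of_mem N hx a, rfl⟩)
    (by
      rintro _ a ⟨x, hx, rfl⟩
      refine ⟨_, N.star_mem (mul_mem_of_mem N (N.star_mem hx) (star a)), ?_⟩
      change star (star a * star (x : A)) = x * a
      rw [star_mul, star_star, star_star])
    ((J.isClosed' : IsClosed (J : Set A)).isClosedEmbedding_subtypeVal.isClosedMap _ N.isClosed')

theorem mem_ofIdeal {J : ClosedIdeal A} {N : ClosedIdeal J} {a : A} :
    a ∈ ofIdeal N ↔ ∃ x ∈ N, (x : A) = a := mem_ofCarrier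

theorem coe_mem_ofIdeal {J : ClosedIdeal A} {N : ClosedIdeal J} {x : J} :
    (x : A) ∈ ofIdeal N ↔ x ∈ N :=
  mem_ofIdeal.trans ⟨fun ⟨_, hy, hyx⟩ => Subtype.ext hyx ▸ hy, fun h => ⟨x, h, rfl⟩⟩

/-- The ideal `M ∩ J` of `J`. -/
noncomputable def restrict (J M : ClosedIdeal A) : ClosedIdeal J :=
  ofCarrier (((↑) : J → A) ⁻¹' (M : Set A)) (zero_mem M) (fun hx hy => add_mem (S := ClosedIdeal A) hx hy)
    (fun hx => neg_mem (S := ClosedIdeal A) hx) (fun {x _} hy => M.mul_mem_left (x : A) hy)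
    (fun {_ y} hx => M.mul_mem_right (y : A) hx) (M.isClosed'.preimage continuous_subtype_val)

theorem mem_restrict {J M : ClosedIdeal A} {x : J} : x ∈ J.restrict M ↔ (x : A) ∈ M :=
  mem_ofCarrier

theorem restrict_mem_maxIdeals {J M : ClosedIdeal A} (hM : M ∈ MaxIdeals A) (hJ : ¬ J ≤ M) :
    J.restrict M ∈ MaxIdeals J := by
  obtain ⟨e, heJ, he⟩ := exists_mem_unit hM hJ
  refine ⟨⟨fun h => hJ fun x hx => ?_, fun I hI => ?_⟩, isModular_iff.2 ⟨⟨e, heJ⟩, fun a => ?_⟩⟩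
  · exact mem_restrict.1 (h ▸ trivial : (⟨x, hx⟩ : J) ∈ J.restrict M)
  · obtain ⟨x, hxI, hxM⟩ := Set.not_subset.1 hI.not_ge
    obtain ⟨i, hi, hiM⟩ := exists_mem_unit hM (J := ofIdeal I) fun hle =>
      hxM (mem_restrict.2 (hle (coe_mem_ofIdeal.2 hxI)))
    obtain ⟨i, hiI, rfl⟩ := mem_ofIdeal.1 hi
    refine eq_top_iff_forall.2 fun j => ?_
    have h1 : i * j - j ∈ I := hI.le (mem_restrict.2 (hiM j).1)
    have h2 := sub_mem (I.mul_mem_right j hiI) h1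
    rwa [sub_sub_cancel] at h2
  · exact ⟨mem_restrict.2 (he a).1, mem_restrict.2 (he a).2⟩

theorem eq_of_restrict_eq {J M M' : ClosedIdeal A} (hM : M ∈ MaxIdeals A) (hM' : M' ∈ MaxIdeals A)
    (hJ : ¬ J ≤ M') (h : J.restrict M = J.restrict M') : M = M' := by
  obtain ⟨e, heJ, he⟩ := exists_mem_unit hM' hJ
  refine eq_of_le_of_mem_maxIdeals hM hM' fun a ha => ?_
  have h1 : (⟨a * e, J.mul_mem_left a heJ⟩ : J) ∈ J.restrict M :=
    mem_restrict.2 (M.mul_mem_right e ha)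
  rw [h, mem_restrict] at h1
  have := sub_mem h1 (he a).2
  rwa [sub_sub_cancel] at this

/-- Every modular maximal ideal of an ideal `J` is the restriction of one of `A`. -/
theorem exists_restrict_eq {J : ClosedIdeal A} {N : ClosedIdeal J} (hN : N ∈ MaxIdeals J) :
    ∃ M ∈ MaxIdeals A, ¬ J ≤ M ∧ J.restrict M = N := by
  obtain ⟨e, he⟩ := isModular_iff.1 hN.2
  have heN : e ∉ N := unit_notMem hN.1.1 fun a => (he a).1
  have he1 : ∀ j ∈ J, (e : A) * j - j ∈ ofIdeal N := fun j hj =>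
    coe_mem_ofIdeal.2 (he ⟨j, hj⟩).1
  let M : ClosedIdeal A := ofCarrier {a | ∀ j ∈ J, a * j ∈ ofIdeal N}
    (fun j _ => by rw [zero_mul]; exact zero_mem _)
    (fun hx hy j hj => by rw [add_mul]; exact add_mem (hx j hj) (hy j hj))
    (fun hx j hj => by rw [neg_mul]; exact neg_mem (hx j hj))
    (fun hy j hj => by rw [mul_assoc]; exact (ofIdeal N).mul_mem_left _ (hy j hj))
    (fun hx j hj => by rw [mul_assoc]; exact hx _ (J.mul_mem_left _ hj))
    (by
      simp only [Set.ofPred_forall]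
      exact isClosed_iInter fun j => isClosed_iInter fun _ =>
        (ofIdeal N).isClosed'.preimage (continuous_id.mul continuous_const))
  have hM : ∀ a, a ∈ M ↔ ∀ j ∈ J, a * j ∈ ofIdeal N := fun a => mem_ofCarrier
  have hres : J.restrict M = N := by
    refine SetLike.ext fun x => ?_
    rw [mem_restrict, hM]
    refine ⟨fun h => ?_, fun h j hj => (ofIdeal N).mul_mem_right j (coe_mem_ofIdeal.2 h)⟩
    have h1 : x * e ∈ N := coe_mem_ofIdeal.1 (h e e.2)
    have := sub_mem h1 (he x).2
    rwa [sub_sub_cancel] at this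
  have heM : (e : A) ∉ M := fun h => heN (hres ▸ mem_restrict.2 h)
  have heu : ∀ a, (e : A) * a - a ∈ M ∧ a * e - a ∈ M := fun a => by
    refine ⟨(hM _).2 fun j hj => ?_, (hM _).2 fun j hj => ?_⟩
    · rw [sub_mul, mul_assoc]; exact he1 _ (J.mul_mem_left a hj)
    · rw [sub_mul, mul_assoc, ← mul_sub]; exact (ofIdeal N).mul_mem_left _ (he1 j hj)
  refine ⟨M, ⟨⟨fun h => heM (h ▸ trivial), fun I hI => ?_⟩, isModular_iff.2 ⟨e, heu⟩⟩,
    fun h => heM (h e.2), hres⟩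
  obtain ⟨a, haI, haM⟩ := Set.not_subset.1 hI.not_ge
  obtain ⟨j, hj, haj⟩ : ∃ j ∈ J, a * j ∉ ofIdeal N := by
    by_contra! hall
    exact haM ((hM a).2 hall)
  have hlt : N < J.restrict I := lt_of_le_of_mem (x := ⟨a * j, J.mul_mem_left a hj⟩)
    (fun x hx => mem_restrict.2 (hI.le (mem_restrict.1 (hres.symm ▸ hx))))
    (mem_restrict.2 (I.mul_mem_right j haI)) fun h => haj (coe_mem_ofIdeal.2 h)
  have heI : (e : A) ∈ I := mem_restrict.1 (hN.1.2 _ hlt ▸ trivial : e ∈ J.restrict I)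
  by_contra hne
  exact unit_notMem hne (fun a => hI.le (heu a).1) heI

/-- The intersection of a modular maximal ideal with the centre is prime. -/
theorem mem_of_mul_mem_of_mem_center {M : ClosedIdeal A} (hM : M ∈ MaxIdeals A) {z w : A}
    (hw : w ∈ Set.center A) (hzw : z * w ∈ M) (hwM : w ∉ M) (hz : z ∈ Set.center A) : z ∈ M := by
  obtain ⟨χ, hχ⟩ := exists_character hM
  have h1 := (hχ (⟨z, hz⟩ * ⟨w, hw⟩)).2 hzw
  rw [map_mul, mul_eq_zero] at h1
  rcases h1 with h1 | h1
  · exact (hχ _).1 h1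
  · exact absurd ((hχ _).1 h1) hwM

end ClosedIdeal

open ClosedIdeal

theorem IsWeaklyCentral.le_ker_T {J : ClosedIdeal A} (h : IsWeaklyCentral J) :
    J ≤ ker (T A) := by
  intro x hx
  rw [ClosedIdeal.mem_ker]
  intro M hMT
  by_contra hxM
  have hM : M ∈ MaxIdeals A := hMT.elim (fun h => h.1) fun h => h.1
  have hJM : ¬ J ≤ M := fun hle => hxM (hle hx)
  have hN := restrict_mem_maxIdeals hM hJM
  obtain ⟨z, hz, hzM⟩ := Set.not_subset.1 (h.1 _ hN)
  replace hzM : (z : A) ∉ M := fun h => hzM (mem_restrict.2 h)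
  have hzc := coe_mem_center_iff.2 hz
  rcases hMT with hT | ⟨-, M', hM', hne, -, -, hMM'⟩
  · exact hzM (hT.2 hzc)
  · have hiff : ∀ z ∈ Set.center A, z ∈ M ↔ z ∈ M' := fun z hz =>
      ⟨fun h => (hMM'.le ⟨h, hz⟩).1, fun h => (hMM'.ge ⟨h, hz⟩).1⟩
    have hJM' : ¬ J ≤ M' := fun hle => hzM ((hiff _ hzc).2 (hle z.2))
    refine hne (eq_of_restrict_eq hM hM' hJM' (h.2 _ hN _ (restrict_mem_maxIdeals hM' hJM') ?_))
    ext w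
    refine and_congr_left fun hw => ?_
    exact mem_restrict.trans ((hiff _ (coe_mem_center_iff.2 hw)).trans mem_restrict.symm)

/-- A modular maximal ideal outside `T_A` containing `Z(A) ∩ K` contains `K`. -/
theorem le_of_center_inter_le {M K : ClosedIdeal A} (hM : M ∈ MaxIdeals A) (hMT : M ∉ T A)
    (hK : ∀ z ∈ Set.center A, z ∈ K → z ∈ M) : K ≤ M := by
  have hMZ : ¬ Set.center A ⊆ (M : Set A) := fun h => hMT (.inl ⟨hM, h⟩)
  obtain ⟨χ, hχ⟩ := exists_character hM
  have hχ0 : χ ≠ 0 := by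
    rintro rfl
    exact hMZ fun z hz => (hχ ⟨z, hz⟩).1 rfl
  obtain ⟨P, hP, hPχ⟩ := exists_maxIdeal_over (K.quotHom.comp centreIncl)
    (fun z x => by
      obtain ⟨a, rfl⟩ := K.toQuot_surjective x
      exact congrArg K.toQuot (centre_comm z a)) χ hχ0
    fun z hz => (hχ z).2 (hK z z.2 (K.toQuot_eq_zero.1 hz))
  have hiff : ∀ z ∈ Set.center A, z ∈ M ↔ z ∈ K.comap P := fun z hz =>
    (hχ ⟨z, hz⟩).symm.trans ((hPχ ⟨z, hz⟩).symm.trans mem_comap.symm)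
  have hcP := comap_mem_maxIdeals hP
  have hMP : M = K.comap P := by
    by_contra hne
    refine hMT (.inr ⟨hM, _, hcP, hne, hMZ, fun h => hMZ fun z hz => (hiff z hz).2 (h hz), ?_⟩)
    ext z
    exact and_congr_left fun hz => hiff z hz
  rw [hMP]
  exact K.le_comap P

theorem isWeaklyCentral_ker_T : IsWeaklyCentral (ker (T A)) := by
  set K := ker (T A)
  have hnotT : ∀ M : ClosedIdeal A, ¬ K ≤ M → M ∉ T A := fun M hKM hMT =>
    hKM fun x hx => ClosedIdeal.mem_ker.1 hx M hMT
  have hex : ∀ M ∈ MaxIdeals A, ¬ K ≤ M → ∃ z ∈ Set.center A, z ∈ K ∧ z ∉ M := by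
    intro M hM hKM
    by_contra! hall
    exact hKM (le_of_center_inter_le hM (hnotT M hKM) hall)
  refine ⟨fun N hN hZ => ?_, fun N₁ h₁ N₂ h₂ h₁₂ => ?_⟩
  · obtain ⟨M, hM, hKM, rfl⟩ := exists_restrict_eq hN
    obtain ⟨z, hz, hzK, hzM⟩ := hex M hM hKM
    exact hzM (mem_restrict.1 (hZ ((coe_mem_center_iff (z := ⟨z, hzK⟩)).1 hz)))
  · obtain ⟨M₁, hM₁, hK₁, rfl⟩ := exists_restrict_eq h₁
    obtain ⟨M₂, hM₂, hK₂, rfl⟩ := exists_restrict_eq h₂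
    have hiff : ∀ z ∈ Set.center A, z ∈ K → (z ∈ M₁ ↔ z ∈ M₂) := fun z hz hzK => by
      have hzc := (coe_mem_center_iff (z := (⟨z, hzK⟩ : K))).1 hz
      exact ⟨fun h => mem_restrict.1 (h₁₂.le ⟨mem_restrict.2 h, hzc⟩).1,
        fun h => mem_restrict.1 (h₁₂.ge ⟨mem_restrict.2 h, hzc⟩).1⟩
    have hsub : ∀ {M M' : ClosedIdeal A}, M' ∈ MaxIdeals A → ¬ K ≤ M' →
        (∀ z ∈ Set.center A, z ∈ K → (z ∈ M ↔ z ∈ M')) →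
        ∀ z ∈ Set.center A, z ∈ M → z ∈ M' := by
      intro M M' hM' hK' hiff z hz hzM
      obtain ⟨w, hw, hwK, hwM'⟩ := hex M' hM' hK'
      refine mem_of_mul_mem_of_mem_center hM' hw ?_ hwM' hz
      exact (hiff _ (Set.mul_mem_center hz hw) (K.mul_mem_left _ hwK)).1 (M.mul_mem_right _ hzM)
    congr 1
    by_contra hne
    refine hnotT M₁ hK₁ (.inr ⟨hM₁, M₂, hM₂, hne, ?_, ?_, ?_⟩)
    · exact fun h => hnotT M₁ hK₁ (.inl ⟨hM₁, h⟩)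
    · exact fun h => hnotT M₂ hK₂ (.inl ⟨hM₂, h⟩)
    · ext z
      exact and_congr_left fun hz => ⟨hsub hM₂ hK₂ hiff z hz,
        hsub hM₁ hK₁ (fun w hw hwK => (hiff w hw hwK).symm) z hz⟩

end CentreQuotient

theorem mainTheorem2 (A : Type*) [NonUnitalCStarAlgebra A] :
    IsGreatest {J : CentreQuotient.ClosedIdeal A | CentreQuotient.IsWeaklyCentral J}
        (CentreQuotient.ClosedIdeal.ker (CentreQuotient.T A)) ∧
      IsGreatest {J : CentreQuotient.ClosedIdeal A | CentreQuotient.HasCQProperty J}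
        (CentreQuotient.ClosedIdeal.ker (CentreQuotient.T A)) :=
  ⟨⟨CentreQuotient.isWeaklyCentral_ker_T, fun _ hJ => hJ.le_ker_T⟩,
    ⟨CentreQuotient.isWeaklyCentral_ker_T.hasCQProperty,
      fun _ hJ => hJ.isWeaklyCentral.le_ker_T⟩⟩
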